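/- **Theorem.** There exists an infinite binary sequence $S\in\{0,1\}^{\omega}$ such that for all real $0<\alpha<1$, $$\text{FS-depth}(S) > 1-\alpha \qquad\text{and}\qquad \text{PD-depth}(S) < \alpha .$$ Here $S\upharpoonright n$ is the prefix of $S$ of length $n$, $|x|$ is the length of a string $x$, and the notions are as follows. *Finite-state depth.* A finite-state transducer (FST) $T$ has states $q_1,\dots,q_m$ ($m\ge 1$), an initial state, a transition function $\delta$ from (state, bit) to states and an output function $\nu$ from (state, bit) to $\{0,1\}^*$; $T(y)$ is the concatenation of the outputs while reading $y$. Let $\mathrm{bin}(n)$ be the binary expansion of $n\geq 1$, $d(x)$ the string $x$ with every bit doubled, $(x_1\cdots x_l)^{\dagger}=x_10x_20\cdots x_{l-1}0x_l1$, and $x^{\diamond}$ the bitwise complement of $(1x)^{\dagger}$. A description of an FST with initial state $q_i$ is a string $d(\mathrm{bin}(i))\,01\,y$, where $y$ is the concatenation, over $j=1,\dots,m$ and $b=0,1$ (in lexicographic order of $(j,b)$), of the blocks $u_{j,b}\,\nu(q_j,b)^{\diamond}$; here $u_{j,b}$ is empty if $\delta(q_j,b)=q_j$, and otherwise $u_{j,b}=\mathrm{bin}(n)^{\dagger}$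 for some $n\ge1$ with $\delta(q_j,b)=q_{1+(n\bmod m)}$. The size of $T$ is the least length of a description of $T$, and $D^k(x)$ is the least length of a string $y$ with $T(y)=x$ for some FST $T$ of size at most $k$ ($\infty$ if there is none). For $\gamma>0$, $\text{FS-depth}(S)\ge\gamma$ means $$(\forall k)(\exists k')(\exists^{\infty}n)\quad D^k(S\upharpoonright n)-D^{k'}(S\upharpoonright n)\ge\gamma n ,$$ and $\text{FS-depth}(S)>\beta$ means that $\text{FS-depth}(S)\ge\gamma$ for some $\gamma>\beta$. *Pushdown depth.* A pushdown compressor $C$ has a finite state set, an initial state, a stack alphabet $\Gamma=\{0,1,z_0\}$ and a stack that initially holds only the bottom symbol $z_0$. A partial transition function maps (state, next input bit or the empty string $\lambda$, top stack symbol) to (state, string in $\Gamma^*$ replacing the top symbol); an output function assigns a string to each (state, bit, top symbol), and $\lambda$-transitions output nothing. The symbol $z_0$ is never removed from the bottom of the stack; for each state and top symbol either no $\lambda$-transition or no bit-reading transition is defined; and for some $c\in\mathbb N$ at most $c$ $\lambda$-transitions can be performed in succession. All possible $\lambda$-transitions are performed at the start and after each bit read. $C(x)$ is the output on input $x$. $C$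 is information lossless if the map sending $x\in\{0,1\}^*$ to the pair ($C(x)$, final state of $C$ on $x$) is defined on all strings and injective. $\mathrm{ILPDC}$ is the class of information lossless pushdown compressors, and $\mathrm{ILUPDC}$ the class defined in the same way with the unary stack alphabet $\{0,z_0\}$. For $\alpha>0$, $\text{PD-depth}(S)\ge\alpha$ means $$(\forall C\in\mathrm{ILUPDC})(\exists C'\in\mathrm{ILPDC})(\forall^{\infty}n)\quad |C(S\upharpoonright n)|-|C'(S\upharpoonright n)|\ge\alpha n ,$$ and $\text{PD-depth}(S)<\alpha$ means that this fails. -/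

import Mathlib

open Filter

/-! Strings are `List Bool` (`false` is the bit 0, `true` the bit 1, the head is the leftmost bit);
infinite binary sequences are functions `ℕ → Bool`. -/

/-- The prefix `S ↾ n` of length `n` of the sequence `S`. -/
def seqPrefix (S : ℕ → Bool) (n : ℕ) : List Bool := (List.range n).map S

/-! ### Finite-state transducers -/

/-- A finite-state transducer with state set `{q_1, …, q_m}`; the state `q_{i+1}` is `i : Fin m`. -/
structure FST (m : ℕ) where
  start : Fin m
  step : Fin m → Bool → Fin m
  out : Fin m → Bool → List Bool

namespace FST

/-- The output produced on a string when it is read from state `q`. -/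
def outputFrom {m : ℕ} (T : FST m) : Fin m → List Bool → List Bool
  | _, [] => []
  | q, b :: w => T.out q b ++ T.outputFrom (T.step q b) w

/-- The output `T(w)`. -/
def output {m : ℕ} (T : FST m) (w : List Bool) : List Bool := T.outputFrom T.start w

end FST

/-! ### Binary representation of transducers and `k`-finite-state complexity -/

/-- The binary expansion of `n`, most significant bit first (it begins with `1` for `n ≥ 1`). -/
def binStr (n : ℕ) : List Bool := n.bits.reverse

/-- `d(x)`: every bit doubled. -/
def doubled (x : List Bool) : List Bool := x.flatMap fun b => [b, b]

/-- `x† = x₁ 0 x₂ 0 … x_{l-1} 0 x_l 1`. -/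
def dagger : List Bool → List Bool
  | [] => []
  | [x] => [x, true]
  | x :: y :: l => x :: false :: dagger (y :: l)

/-- `x^⋄`: the bitwise complement of `(1x)†`. -/
def diamond (x : List Bool) : List Bool := (dagger (true :: x)).map not

namespace FST

/-- The encoding of the transition table of `T` in which the target of the transition from `q` on
the bit `b` is given by the positive number `ν q b`; nothing is written for a target `q` itself. -/
def encodeTable {m : ℕ} (T : FST m) (ν : Fin m → Bool → ℕ) : List Bool :=
  (List.finRange m).flatMap fun q =>
    [false, true].flatMap fun b =>
      (if T.step q b = q then [] else dagger (binStr (ν q b))) ++ diamond (T.out q b)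

/-- `x` is a description of `T`: `x = d(bin(i)) 0 1 y`, where `q_i` is the initial state and `y`
encodes the transition table, the number `n ≥ 1` standing for the state `q_{1 + (n mod m)}`. -/
def IsDescription {m : ℕ} (T : FST m) (x : List Bool) : Prop :=
  ∃ ν : Fin m → Bool → ℕ,
    (∀ q b, 1 ≤ ν q b ∧ ν q b % m = (T.step q b : ℕ)) ∧
    x = doubled (binStr ((T.start : ℕ) + 1)) ++ [false, true] ++ T.encodeTable ν

/-- The size `|T|`: the least length of a description of `T`. -/
noncomputable def size {m : ℕ} (T : FST m) : ℕ∞ :=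
  ⨅ (x : List Bool) (_ : T.IsDescription x), (x.length : ℕ∞)

end FST

/-- The `k`-finite-state complexity `D^k(x)`: the least length of an input on which some transducer
of size at most `k` outputs `x`, and `∞` if there is none. -/
noncomputable def fsComplexity (k : ℕ) (x : List Bool) : ℕ∞ :=
  ⨅ (m : ℕ) (T : FST m) (_ : T.size ≤ k) (y : List Bool) (_ : T.output y = x), (y.length : ℕ∞)

/-- FS-depth`(S) ≥ α`. The difference is taken in the extended reals (where `∞ - ∞ = -∞`). -/
def FSDepthGE (S : ℕ → Bool) (α : ℝ) : Prop :=
  ∀ k : ℕ, ∃ k' : ℕ, ∃ᶠ n : ℕ in atTop,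
    ((α * n : ℝ) : EReal) ≤
      ((fsComplexity k (seqPrefix S n) : ENNReal) : EReal) -
        ((fsComplexity k' (seqPrefix S n) : ENNReal) : EReal)

/-- FS-depth`(S) > β`: the sequence has finite-state depth at least some level above `β`. -/
def FSDepthGT (S : ℕ → Bool) (β : ℝ) : Prop := ∃ γ : ℝ, β < γ ∧ FSDepthGE S γ

/-! ### Pushdown compressors -/

/-- The stack alphabet `A ∪ {z₀}`. -/
inductive StackSym (A : Type) where
  | bottom : StackSym A
  | sym : A → StackSym A

/-- One move of a (partial) pushdown transition function `δ` on a state and a stack (topmost symbol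
first), reading the bit `b`, or reading nothing if `b = none`. -/
def pdMove {Q A : Type}
    (δ : Q → Option Bool → StackSym A → Option (Q × List (StackSym A)))
    (b : Option Bool) : Q × List (StackSym A) → Option (Q × List (StackSym A))
  | (_, []) => none
  | (q, a :: v) => (δ q b a).map fun r => (r.1, r.2 ++ v)

/-- The result of exactly `n` successive moves without reading input, if they are all possible. -/
def pdLambdaIter {Q A : Type}
    (δ : Q → Option Bool → StackSym A → Option (Q × List (StackSym A))) :
    ℕ → Q × List (StackSym A) → Option (Q × List (StackSym A))
  | 0, s => some s
  | n + 1, s => (pdMove δ none s).bind (pdLambdaIter δ n)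

/-- A pushdown compressor with stack alphabet `A ∪ {z₀}` and state set `Fin numStates`. The value
`none` of `δ` means that the transition is undefined, the input `none` is the empty string. -/
structure PDC (A : Type) where
  numStates : ℕ
  δ : Fin numStates → Option Bool → StackSym A → Option (Fin numStates × List (StackSym A))
  ν : Fin numStates → Option Bool → StackSym A → List Bool
  q₀ : Fin numStates
  /-- upper bound on the number of successive `λ`-transitions -/
  c : ℕ
  /-- the bottom symbol cannot be popped -/
  bottom_stays : ∀ q b q' u, δ q b StackSym.bottom = some (q', u) →
    ∃ v, u = v ++ [StackSym.bottom]
  /-- determinism -/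
  deterministic : ∀ q a, δ q none a = none ∨ ∀ b : Bool, δ q (some b) a = none
  /-- at most `c` `λ`-transitions can be performed in succession -/
  lambda_bound : ∀ s, pdLambdaIter δ (c + 1) s = none
  /-- nothing is output on `λ`-transitions -/
  lambda_output : ∀ q a, ν q none a = []

namespace PDC

variable {A : Type}

/-- Perform `λ`-transitions while possible, but at most `n` of them. -/
def lambdaClosure (C : PDC A) :
    ℕ → Fin C.numStates × List (StackSym A) → Fin C.numStates × List (StackSym A)
  | 0, s => s
  | n + 1, s =>
    match pdMove C.δ none s with
    | none => s
    | some s' => C.lambdaClosure n s'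

/-- The output of the transition on the bit `b` from a state and a stack. -/
def bitOutput (C : PDC A) (b : Bool) : Fin C.numStates × List (StackSym A) → List Bool
  | (_, []) => []
  | (q, a :: _) => C.ν q (some b) a

/-- Read a string from a state and a stack on which no `λ`-transition is pending; after each bit all
possible `λ`-transitions are performed. The result is the final state and stack with the output, or
`none` if the machine gets stuck. -/
def runFrom (C : PDC A) : Fin C.numStates × List (StackSym A) → List Bool →
    Option ((Fin C.numStates × List (StackSym A)) × List Bool)
  | s, [] => some (s, [])
  | s, b :: w =>
    (pdMove C.δ (some b) s).bind fun s' =>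
      (C.runFrom (C.lambdaClosure C.c s') w).map fun r => (r.1, C.bitOutput b s ++ r.2)

/-- The run of the compressor on `w`, from the initial state with the stack `z₀`. -/
def run (C : PDC A) (w : List Bool) :
    Option ((Fin C.numStates × List (StackSym A)) × List Bool) :=
  C.runFrom (C.lambdaClosure C.c (C.q₀, [StackSym.bottom])) w

/-- The output `C(w)` (empty by convention if the machine gets stuck on `w`, which does not happen
for the information lossless compressors below). -/
def output (C : PDC A) (w : List Bool) : List Bool := ((C.run w).map Prod.snd).getD []

/-- Information losslessness: `x ↦ (C(x), final state of C on x)` is a (total) injective function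
on the set of all strings. -/
def IsIL (C : PDC A) : Prop :=
  (∀ x, (C.run x).isSome) ∧
    ∀ x y r s, C.run x = some r → C.run y = some s → r.2 = s.2 → r.1.1 = s.1.1 → x = y

end PDC

/-- Information lossless pushdown compressors: stack alphabet `{0, 1, z₀}`. -/
def ILPDC : Set (PDC Bool) := {C | C.IsIL}

/-- Information lossless unary-stack pushdown compressors: stack alphabet `{0, z₀}`. -/
def ILUPDC : Set (PDC Unit) := {C | C.IsIL}

/-- PD-depth`(S) ≥ α`. -/
def PDDepthGE (S : ℕ → Bool) (α : ℝ) : Prop :=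
  ∀ C ∈ ILUPDC, ∃ C' ∈ ILPDC, ∀ᶠ n : ℕ in atTop,
    α * n ≤ ((C.output (seqPrefix S n)).length : ℝ) - ((C'.output (seqPrefix S n)).length : ℝ)

/-- PD-depth`(S) < α`. -/
def PDDepthLT (S : ℕ → Bool) (α : ℝ) : Prop := ¬ PDDepthGE S α

/-! ### Generic sequences -/

/-! A Baire-generic sequence works: FS-depth asks for a gap only at infinitely many prefixes, while
failure of PD-depth also needs only infinitely many bad prefixes. There are countably many
requirements, and each can be met by extending any given string, so `exists_sequence_frequently`
meets them all infinitely often.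

For pushdown compressors, counting gives an extension that a given lossless compressor barely
shortens (`PDC.IsIL.exists_incompressible_extension`); comparison with the copying compressor then
refutes PD-depth at level α.

For finite-state depth, append many copies of one long block `r` that no transducer of size at most
`k` produces cheaply from any state. Small transducers pay almost `r.length` per copy, whereas a
transducer with `r` built in pays one bit (`exists_extension_fsComplexity_gap`). -/

theorem length_seqPrefix (S : ℕ → Bool) (n : ℕ) : (seqPrefix S n).length = n := by
  simp [seqPrefix]

theorem seqPrefix_congr {S S' : ℕ → Bool} {n : ℕ} (h : ∀ i < n, S i = S' i) :
    seqPrefix S n = seqPrefix S' n :=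
  List.map_congr_left fun i hi => h i (List.mem_range.1 hi)

theorem seqPrefix_getD (w : List Bool) :
    seqPrefix (fun i => w.getD i false) w.length = w := by
  apply List.ext_getElem
  · simp [seqPrefix]
  · intro i h₁ h₂
    simp [seqPrefix, h₂]

/-- If every string can be extended so as to meet any one of countably many requirements, then some
sequence has, for each of the requirements, infinitely many prefixes that meet it. -/
theorem exists_sequence_frequently {ι : Type*} [Countable ι] (R : ι → List Bool → Prop)
    (hR : ∀ i u, ∃ v, R i (u ++ v)) : ∃ S : ℕ → Bool, ∀ i, ∃ᶠ n in atTop, R i (seqPrefix S n) := by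
  let U : ι × ℕ → Set (ℕ → Bool) := fun p => {S | ∃ n, p.2 ≤ n ∧ R p.1 (seqPrefix S n)}
  have hopen : ∀ p, IsOpen (U p) := by
    intro p
    rw [(PiNat.isTopologicalBasis_cylinders (fun _ : ℕ => Bool)).isOpen_iff]
    rintro S ⟨n, hn, h⟩
    refine ⟨PiNat.cylinder S n, ⟨S, n, rfl⟩, PiNat.self_mem_cylinder S n, fun S' hS' => ⟨n, hn, ?_⟩⟩
    rwa [seqPrefix_congr fun i hi => PiNat.mem_cylinder_iff.1 hS' i hi]
  have hdense : ∀ p, Dense (U p) := by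
    intro p
    rw [(PiNat.isTopologicalBasis_cylinders (fun _ : ℕ => Bool)).dense_iff]
    rintro _ ⟨S, n, rfl⟩ -
    -- Lengthening the cylinder's prefix to at least `p.2` ensures that the requirement is met
    -- beyond position `p.2`.
    obtain ⟨v, hv⟩ := hR p.1 (seqPrefix S (max n p.2))
    have hl : (seqPrefix S (max n p.2)).length = max n p.2 := length_seqPrefix _ _
    refine ⟨fun i => (seqPrefix S (max n p.2) ++ v).getD i false, ?_,
      (seqPrefix S (max n p.2) ++ v).length, ?_, ?_⟩
    · rw [PiNat.mem_cylinder_iff]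
      intro i hi
      have hi' : i < (seqPrefix S (max n p.2)).length := by omega
      rw [List.getD_append _ _ _ _ hi', List.getD_eq_getElem _ _ hi']
      simp [seqPrefix]
    · rw [List.length_append]; omega
    · rwa [seqPrefix_getD]
  obtain ⟨S, hS⟩ := (dense_iInter_of_isOpen hopen hdense).nonempty
  refine ⟨S, fun i => frequently_atTop.2 fun N => ?_⟩
  obtain ⟨n, hn, h⟩ := Set.mem_iInter.1 hS (i, N)
  exact ⟨n, hn, h⟩

/-! ### Counting -/

/-- Finitely many decoders cannot produce all strings of length `L` from codes that are
sufficiently shorter than `L`. -/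
theorem exists_incompressible {I : Type*} [Finite I] :
    ∃ d : ℕ, ∀ (g : I → List Bool → List Bool) (L : ℕ), ∃ r : List Bool, r.length = L ∧
      ∀ i w, g i w = r → L ≤ w.length + d := by
  have := Fintype.ofFinite I
  refine ⟨Fintype.card I, fun g L => ?_⟩
  by_contra! hcon
  set d := Fintype.card I
  -- There are fewer than `2 ^ (L - d)` codes of length below `L - d`, so `d < 2 ^ d` decoders
  -- cannot cover all `2 ^ L` strings.
  let f : (I × Σ j : Fin (L - d), (Fin j → Bool)) → (Fin L → Bool) :=
    fun p i => (g p.1 (List.ofFn p.2.2)).getD i false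
  have hf : Function.Surjective f := by
    intro x
    obtain ⟨i, w, hw, hlt⟩ := hcon (List.ofFn x) (List.length_ofFn)
    refine ⟨(i, ⟨⟨w.length, by omega⟩, w.get⟩), ?_⟩
    funext j
    simp only [f, List.ofFn_get, hw]
    rw [List.getD_eq_getElem _ _ (by simp)]
    simp
  have hpos : 0 < L - d := by
    obtain ⟨i, w, -, hlt⟩ := hcon (List.replicate L false) (List.length_replicate)
    omega
  have hcard := Fintype.card_le_of_surjective f hf
  simp only [Fintype.card_prod, Fintype.card_sigma, Fintype.card_pi, Fintype.card_bool,
    Finset.prod_const, Finset.card_univ, Fintype.card_fin] at hcard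
  rw [Fin.sum_univ_eq_sum_range (fun j => 2 ^ j) (L - d)] at hcard
  have h₁ : ∑ j ∈ Finset.range (L - d), 2 ^ j < 2 ^ (L - d) :=
    Nat.geomSum_lt le_rfl (by simp)
  have h₂ : d < 2 ^ d := Nat.lt_two_pow_self
  have h₃ : 2 ^ L = 2 ^ d * 2 ^ (L - d) := by rw [← pow_add]; congr 1; omega
  exact absurd (h₃ ▸ hcard) (Nat.mul_lt_mul'' h₂ h₁).not_ge

/-! ### Incompressibility by pushdown compressors -/

instance : Finite (StackSym Bool) :=
  Finite.of_injective (fun a : StackSym Bool => match a with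
    | .bottom => (none : Option Bool)
    | .sym b => some b) (by rintro (_ | _) (_ | _) <;> simp)

instance : Countable (PDC Bool) := by
  have (n : ℕ) : Countable (Option (Fin n × List (StackSym Bool))) := inferInstance
  have (n : ℕ) : Countable (Option Bool → StackSym Bool →
      Option (Fin n × List (StackSym Bool))) := inferInstance
  refine Function.Injective.countable (β := Σ n : ℕ,
    (Fin n → Option Bool → StackSym Bool → Option (Fin n × List (StackSym Bool))) ×
    (Fin n → Option Bool → StackSym Bool → List Bool) × Fin n × ℕ)
    (f := fun C => ⟨C.numStates, C.δ, C.ν, C.q₀, C.c⟩) ?_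
  rintro ⟨n, δ, ν, q, c, _, _, _, _⟩ ⟨n', δ', ν', q', c', _, _, _, _⟩ h
  simp only [Sigma.mk.injEq] at h
  obtain ⟨rfl, h⟩ := h
  simp only [heq_eq_eq, Prod.mk.injEq] at h
  obtain ⟨rfl, rfl, rfl, rfl⟩ := h
  rfl

/-- Every string has extensions that a given information lossless compressor hardly compresses. -/
theorem PDC.IsIL.exists_incompressible_extension {A : Type} {C : PDC A} (hC : C.IsIL) {ε : ℝ}
    (hε : 0 < ε) (u : List Bool) :
    ∃ v, (1 - ε) * (u ++ v).length ≤ (C.output (u ++ v)).length := by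
  classical
  obtain ⟨d, hd⟩ := exists_incompressible (I := Fin C.numStates)
  let P : Fin C.numStates → List Bool → List Bool → Prop := fun q o v =>
    ∃ r, C.run (u ++ v) = some r ∧ r.2 = o ∧ r.1.1 = q
  -- This makes `ε * L` absorb both the prefix `u` and the counting loss `d`.
  obtain ⟨L, hL⟩ := exists_nat_ge ((u.length + d) / ε)
  -- One decoder per final state: losslessness makes the output together with that state determine
  -- `v`.
  obtain ⟨v, hv, h⟩ := hd (fun q o => if h : ∃ v, P q o v then h.choose else []) L
  refine ⟨v, ?_⟩
  obtain ⟨r, hr⟩ := Option.isSome_iff_exists.1 (hC.1 (u ++ v))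
  have hex : ∃ v, P r.1.1 r.2 v := ⟨v, r, hr, rfl, rfl⟩
  have hlen : L ≤ r.2.length + d := by
    apply h r.1.1 r.2
    rw [dif_pos hex]
    obtain ⟨r', h₁, h₂, h₃⟩ := hex.choose_spec
    exact List.append_cancel_left (hC.2 _ _ _ _ h₁ hr h₂ h₃)
  have hout : C.output (u ++ v) = r.2 := by simp [PDC.output, hr]
  have hlen' : (L : ℝ) ≤ r.2.length + d := by exact_mod_cast hlen
  rw [div_le_iff₀ hε] at hL
  rw [hout, List.length_append, hv, Nat.cast_add]
  nlinarith [mul_nonneg hε.le (Nat.cast_nonneg (α := ℝ) u.length)]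

/-- The compressor that copies its input. -/
def PDC.copier (A : Type) : PDC A where
  numStates := 1
  δ q b a := b.map fun _ => (q, [a])
  ν _ b _ := b.toList
  q₀ := 0
  c := 0
  bottom_stays := by
    rintro q b q' u h
    exact ⟨[], by simp_all⟩
  deterministic _ _ := Or.inl rfl
  lambda_bound := by rintro ⟨q, _ | ⟨a, v⟩⟩ <;> rfl
  lambda_output _ _ := rfl

theorem PDC.copier_runFrom {A : Type} (q : Fin 1) (a : StackSym A) (v : List (StackSym A))
    (w : List Bool) :
    (PDC.copier A).runFrom (q, a :: v) w = some ((q, a :: v), w) := by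
  induction w with
  | nil => rfl
  | cons b w ih =>
    have h : (PDC.copier A).runFrom (q, a :: v) (b :: w) =
        ((PDC.copier A).runFrom (q, a :: v) w).map fun r => (r.1, b :: r.2) := rfl
    rw [h, ih]; rfl

theorem PDC.copier_run {A : Type} (w : List Bool) :
    (PDC.copier A).run w = some (((PDC.copier A).q₀, [StackSym.bottom]), w) :=
  PDC.copier_runFrom _ _ _ w

theorem PDC.copier_isIL (A : Type) : (PDC.copier A).IsIL := by
  refine ⟨fun x => by rw [PDC.copier_run]; rfl, fun x y r s hr hs h _ => ?_⟩
  rw [PDC.copier_run, Option.some.injEq] at hr hs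
  simpa [← hr, ← hs] using h

theorem PDC.copier_output {A : Type} (w : List Bool) : (PDC.copier A).output w = w := by
  simp [PDC.output, PDC.copier_run]

/-! ### Sizes of transducers -/

theorem length_dagger : ∀ x : List Bool, (dagger x).length = 2 * x.length
  | [] => rfl
  | [_] => rfl
  | x :: y :: l => by simp only [dagger, List.length_cons, length_dagger (y :: l)]; ring

theorem length_diamond (x : List Bool) : (diamond x).length = 2 * x.length + 2 := by
  rw [diamond, List.length_map, length_dagger, List.length_cons]; ring

namespace FST

variable {m : ℕ}

/-- Every pair (state, bit) contributes a `diamond` block of length at least 2, and twice the output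
length more. Hence size bounds both the number of states and the output lengths, which makes
`finite_size_le` true. -/
theorem length_out_add_le_length_encodeTable (T : FST m) (ν : Fin m → Bool → ℕ) (q : Fin m)
    (b : Bool) : m + (T.out q b).length ≤ (T.encodeTable ν).length := by
  rw [encodeTable, List.length_flatMap, ← Fin.sum_univ_def]
  calc m + (T.out q b).length
      = ∑ a : Fin m, (1 + if a = q then (T.out q b).length else 0) := by
        simp [Finset.sum_add_distrib]
    _ ≤ _ := Finset.sum_le_sum fun a _ => ?_
  rw [List.length_flatMap]
  split_ifs with h
  · subst h
    cases b <;> simp [length_diamond] <;> omega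
  · simp [length_diamond]; omega

theorem exists_isDescription (T : FST m) : ∃ x, T.IsDescription x := by
  have hm : 1 ≤ m := T.start.pos
  -- Adding `m` keeps the residue and makes the number positive even for target 0.
  refine ⟨_, fun q b => T.step q b + m, fun q b => ⟨hm.trans (Nat.le_add_left _ _), ?_⟩, rfl⟩
  rw [Nat.add_mod_right, Nat.mod_eq_of_lt (T.step q b).isLt]

theorem exists_size_le (T : FST m) : ∃ k : ℕ, T.size ≤ k := by
  obtain ⟨x, hx⟩ := T.exists_isDescription
  exact ⟨x.length, iInf₂_le x hx⟩

theorem length_out_add_le_of_size_le {T : FST m} {k : ℕ} (h : T.size ≤ k) (q : Fin m) (b : Bool) :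
    m + (T.out q b).length ≤ k := by
  by_contra! hlt
  have : ((k + 1 : ℕ) : ℕ∞) ≤ T.size := by
    refine le_iInf₂ fun x hx => ?_
    obtain ⟨ν, -, rfl⟩ := hx
    have := T.length_out_add_le_length_encodeTable ν q b
    exact_mod_cast (by simp only [List.length_append]; omega)
  have := this.trans h
  norm_cast at this
  omega

/-- There are only finitely many transducers of a given size. -/
theorem finite_size_le (k : ℕ) : Finite {T : Σ m, FST m // T.2.size ≤ k} := by
  have : Finite {w : List Bool // w.length ≤ k} := List.finite_length_le Bool k
  refine Finite.of_injective (β := Σ m : Fin (k + 1), Fin m × (Fin m → Bool → Fin m) ×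
      (Fin m → Bool → {w : List Bool // w.length ≤ k}))
    (fun T => ⟨⟨T.1.1, ?_⟩, T.1.2.start, T.1.2.step, fun q b => ⟨T.1.2.out q b, ?_⟩⟩) ?_
  · have := length_out_add_le_of_size_le T.2 T.1.2.start false
    omega
  · have := length_out_add_le_of_size_le T.2 q b
    omega
  · rintro ⟨⟨m, s, t, o⟩, hT⟩ ⟨⟨m', s', t', o'⟩, hT'⟩ h
    simp only [Sigma.mk.injEq, Fin.mk.injEq] at h
    obtain ⟨rfl, h⟩ := h
    simp only [heq_eq_eq, Prod.mk.injEq] at h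
    obtain ⟨rfl, rfl, h⟩ := h
    congr 3
    funext q b
    exact congrArg Subtype.val (congrFun (congrFun h q) b)

/-! ### Transducer outputs -/

/-- The state reached from `q` by reading a string. -/
def stateFrom (T : FST m) (q : Fin m) (w : List Bool) : Fin m := w.foldl T.step q

theorem outputFrom_append (T : FST m) (q : Fin m) (x y : List Bool) :
    T.outputFrom q (x ++ y) = T.outputFrom q x ++ T.outputFrom (T.stateFrom q x) y := by
  induction x generalizing q with
  | nil => rfl
  | cons b x ih => simp [outputFrom, ih, stateFrom]

/-- The bit on reading which a transducer has produced `p` bits of output. -/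
theorem exists_split_of_le_length_outputFrom (T : FST m) (q : Fin m) (y : List Bool) {p : ℕ}
    (hp : 0 < p) (h : p ≤ (T.outputFrom q y).length) :
    ∃ x b z, y = x ++ b :: z ∧ (T.outputFrom q x).length < p ∧
      p ≤ (T.outputFrom q (x ++ [b])).length := by
  induction y using List.reverseRecOn with
  | nil => simp [outputFrom] at h; omega
  | append_singleton x b ih =>
    by_cases hx : p ≤ (T.outputFrom q x).length
    · obtain ⟨x', b', z, rfl, h₁, h₂⟩ := ih hx
      exact ⟨x', b', z ++ [b], by simp, h₁, h₂⟩
    · exact ⟨x, b, [], rfl, by omega, h⟩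

/-- If producing `r`, after at most `k` other bits, takes `c + 1` input bits, then producing `N`
successive copies of `r` takes `N * c` input bits. -/
theorem mul_le_length_of_prefix_outputFrom {T : FST m} {k c : ℕ} {r : List Bool} (hr : r ≠ [])
    (hk : ∀ q b, (T.out q b).length ≤ k)
    (hT : ∀ q w, ∀ i ≤ k, ((T.outputFrom q w).drop i).take r.length = r → c + 1 ≤ w.length) :
    ∀ (N i : ℕ) (q : Fin m) (y : List Bool), i ≤ k →
      (List.replicate N r).flatten <+: (T.outputFrom q y).drop i → N * c ≤ y.length := by
  intro N
  induction N with
  | zero => simp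
  | succ N ih =>
    intro i q y hi h
    have hr0 : 0 < r.length := List.length_pos_iff.2 hr
    obtain ⟨z, hz⟩ := h
    rw [List.replicate_succ, List.flatten_cons, List.append_assoc] at hz
    have hlen : i + r.length ≤ (T.outputFrom q y).length := by
      have := congrArg List.length hz
      simp only [List.length_append, List.length_drop] at this
      omega
    obtain ⟨x, b, w, rfl, h₁, h₂⟩ :=
      T.exists_split_of_le_length_outputFrom q y (by omega) hlen
    have hxb : c + 1 ≤ (x ++ [b]).length := by
      refine hT q (x ++ [b]) i hi ?_
      have e : x ++ b :: w = (x ++ [b]) ++ w := by simp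
      rw [e, outputFrom_append, List.drop_append_of_le_length (by omega)] at hz
      have := congrArg (List.take r.length) hz
      rw [List.take_left, List.take_append_of_le_length (by rw [List.length_drop]; omega)] at this
      exact this.symm
    -- The bit `b` that completes the first copy may already emit part of the next one. The
    -- induction therefore restarts at `b`, not after it, with an offset into the output of `b`; `b`
    -- is counted twice, which is why `c + 1` bits per copy yield only `c`.
    have hoff : i + r.length - (T.outputFrom q x).length ≤ k := by
      have := hk (T.stateFrom q x) b
      rw [outputFrom_append, List.length_append] at h₂
      simp only [outputFrom, List.append_nil] at h₂
      omega
    have hw := ih (i + r.length - (T.outputFrom q x).length) (T.stateFrom q x) (b :: w) hoff ⟨z, by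
      have := congrArg (List.drop r.length) hz
      rw [List.drop_left, List.drop_drop, outputFrom_append, List.drop_append,
        List.drop_eq_nil_of_le (by omega), List.nil_append] at this
      exact this⟩
    simp only [List.length_append, List.length_cons, List.length_nil] at hxb hw ⊢
    rw [Nat.succ_mul]
    omega

/-- The prefix `u` is skipped by restarting at the bit that completes it, again with offset at most
`k`. -/
theorem mul_le_length_of_output_eq {T : FST m} {k c : ℕ} {r : List Bool} (hr : r ≠ [])
    (hk : ∀ q b, (T.out q b).length ≤ k)
    (hT : ∀ q w, ∀ i ≤ k, ((T.outputFrom q w).drop i).take r.length = r → c + 1 ≤ w.length)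
    {N : ℕ} {u y : List Bool} (h : T.output y = u ++ (List.replicate N r).flatten) :
    N * c ≤ y.length := by
  have key := mul_le_length_of_prefix_outputFrom hr hk hT N
  rw [output] at h
  rcases Nat.eq_zero_or_pos u.length with hu | hu
  · rw [List.length_eq_zero_iff] at hu
    exact key 0 T.start y (Nat.zero_le _) (by simp [h, hu])
  · obtain ⟨x, b, w, rfl, h₁, h₂⟩ := T.exists_split_of_le_length_outputFrom T.start y hu (by simp [h])
    have hw := key (u.length - (T.outputFrom T.start x).length) (T.stateFrom T.start x) (b :: w) (by
        have := hk (T.stateFrom T.start x) b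
        rw [outputFrom_append, List.length_append] at h₂
        simp only [outputFrom, List.append_nil] at h₂
        omega) ⟨[], by
      have := congrArg (List.drop u.length) h
      rw [List.drop_left, outputFrom_append, List.drop_append,
        List.drop_eq_nil_of_le (by omega), List.nil_append] at this
      rw [this, List.append_nil]⟩
    rw [List.length_append]
    omega

/-- The transducer that copies every bit preceded by a `0`, and after a `1` in place of such a `0`
outputs `r` for every further bit. -/
def repeater (r : List Bool) : FST 3 where
  start := 0
  step q b := if q = 0 then (if b then 2 else 1) else if q = 1 then 0 else 2
  out q b := if q = 0 then [] else if q = 1 then [b] else r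

theorem repeater_outputFrom_two (r : List Bool) (N : ℕ) :
    (repeater r).outputFrom 2 (List.replicate N false) = (List.replicate N r).flatten := by
  induction N with
  | zero => rfl
  | succ N ih =>
    rw [List.replicate_succ, List.replicate_succ, List.flatten_cons, ← ih]; rfl

theorem repeater_output (r u : List Bool) (N : ℕ) :
    (repeater r).output ((u.flatMap fun b => [false, b]) ++ true :: List.replicate N false) =
      u ++ (List.replicate N r).flatten := by
  induction u with
  | nil => exact repeater_outputFrom_two r N
  | cons b u ih => exact congrArg (List.cons b) ih

end FST

/-! ### Depth of finite-state complexity -/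

/-- The size bound depends on `r` alone: `u` costs two bits per symbol, the switch one bit, and each
copy of `r` one bit. -/
theorem fsComplexity_repeat_le (r : List Bool) : ∃ k : ℕ, ∀ (u : List Bool) (N : ℕ),
    fsComplexity k (u ++ (List.replicate N r).flatten) ≤ (2 * u.length + 1 + N : ℕ) := by
  obtain ⟨k, hk⟩ := (FST.repeater r).exists_size_le
  refine ⟨k, fun u N => ?_⟩
  unfold fsComplexity
  refine iInf_le_of_le 3 <| iInf_le_of_le (FST.repeater r) <| iInf_le_of_le hk <|
    iInf_le_of_le _ <| iInf_le_of_le (FST.repeater_output r u N) ?_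
  norm_cast
  simp [List.length_flatMap]
  omega

theorem exists_le_fsComplexity_repeat (k : ℕ) : ∃ d : ℕ, ∀ L : ℕ, 0 < L →
    ∃ r : List Bool, r.length = L ∧ ∀ (u : List Bool) (N : ℕ),
      (N * (L - d) : ℕ) ≤ fsComplexity k (u ++ (List.replicate N r).flatten) := by
  have := FST.finite_size_le k
  obtain ⟨d, hd⟩ := exists_incompressible
    (I := Σ T : {T : Σ m, FST m // T.2.size ≤ k}, Fin T.1.1 × Fin (k + 1))
  -- The extra 1 pays for the input bit shared by consecutive copies.
  refine ⟨d + 1, fun L hL => ?_⟩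
  -- A copy of `r` may begin in any state and inside the output of a single bit, so the decoders
  -- range over transducer, state and offset.
  obtain ⟨r, hr, h⟩ := hd (fun p w => ((p.1.1.2.outputFrom p.2.1 w).drop p.2.2).take L) L
  refine ⟨r, hr, fun u N => ?_⟩
  refine le_iInf fun m => le_iInf fun T => le_iInf fun hT => le_iInf fun y => le_iInf fun hy => ?_
  norm_cast
  rcases Nat.lt_or_ge d L with hdL | hdL
  · refine FST.mul_le_length_of_output_eq (k := k) (by rintro rfl; simp at hr; omega)
      (fun q b => ?_) (fun q w i hi hw => ?_) hy
    · have := FST.length_out_add_le_of_size_le hT q b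
      omega
    · have := h ⟨⟨⟨m, T⟩, hT⟩, q, ⟨i, by omega⟩⟩ w (by rwa [hr] at hw)
      omega
  · rw [Nat.sub_eq_zero_of_le (by omega), mul_zero]
    exact Nat.zero_le _

theorem coe_natCast_eq (n : ℕ) : (((n : ℕ∞) : ENNReal) : EReal) = ((n : ℝ) : EReal) := by
  rw [ENat.toENNReal_coe, ← ENNReal.ofReal_natCast, EReal.coe_ennreal_ofReal,
    max_eq_left (Nat.cast_nonneg n)]

/-- For every `k` some `k'` is such that every string has extensions whose `k`-finite-state
complexity is nearly maximal while their `k'`-finite-state complexity is nearly `0`. -/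
theorem exists_extension_fsComplexity_gap (k : ℕ) {ε : ℝ} (hε : 0 < ε) :
    ∃ k' : ℕ, ∀ u : List Bool, ∃ v : List Bool,
      (((1 - ε) * (u ++ v).length : ℝ) : EReal) ≤
        ((fsComplexity k (u ++ v) : ENNReal) : EReal) -
          ((fsComplexity k' (u ++ v) : ENNReal) : EReal) := by
  obtain ⟨d, hd⟩ := exists_le_fsComplexity_repeat k
  -- Each copy loses `d` in the lower bound and 1 in the upper bound; this choice makes `d + 1` at
  -- most `ε * L / 2`. As `L` and `r` precede `u`, so does `k'`.
  obtain ⟨L, hL⟩ := exists_nat_ge (2 * (d + 1) / ε)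
  have hL0 : 0 < L := by
    have : (0 : ℝ) < L := lt_of_lt_of_le (by positivity) hL
    exact_mod_cast this
  obtain ⟨r, hr, hlow⟩ := hd L hL0
  obtain ⟨k', hup⟩ := fsComplexity_repeat_le r
  refine ⟨k', fun u => ?_⟩
  -- The remaining loss, at most `3 * u.length + 1`, is absorbed by the other half `ε * N * L / 2`.
  obtain ⟨N, hN⟩ := exists_nat_ge ((6 * u.length + 2) / ε)
  refine ⟨(List.replicate N r).flatten, ?_⟩
  set D := fsComplexity k (u ++ (List.replicate N r).flatten)
  set D' := fsComplexity k' (u ++ (List.replicate N r).flatten)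
  have h₁ : (((N * (L - d) : ℕ) : ℝ) : EReal) ≤ ((D : ENNReal) : EReal) := by
    have : (((N * (L - d) : ℕ) : ℕ∞) : ENNReal) ≤ D := ENat.toENNReal_le.2 (hlow u N)
    exact (coe_natCast_eq _).ge.trans (EReal.coe_ennreal_le_coe_ennreal_iff.2 this)
  have h₂ : ((D' : ENNReal) : EReal) ≤ (((2 * u.length + 1 + N : ℕ) : ℝ) : EReal) := by
    have : (D' : ENNReal) ≤ (((2 * u.length + 1 + N : ℕ) : ℕ∞) : ENNReal) :=
      ENat.toENNReal_le.2 (hup u N)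
    exact (EReal.coe_ennreal_le_coe_ennreal_iff.2 this).trans (coe_natCast_eq _).le
  -- `D` may be infinite, but `D'` is finite by `h₂`, so `∞ - ∞` does not occur.
  refine le_trans ?_ (EReal.sub_le_sub h₁ h₂)
  rw [← EReal.coe_sub, EReal.coe_le_coe_iff]
  have hsub : (L : ℝ) - d ≤ ((L - d : ℕ) : ℝ) := by
    rw [sub_le_iff_le_add]
    exact_mod_cast (by omega : L ≤ L - d + d)
  rw [div_le_iff₀ hε] at hL hN
  have hL1 : (1 : ℝ) ≤ L := by exact_mod_cast hL0
  have hN0 : (0 : ℝ) ≤ N := Nat.cast_nonneg N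
  have a₁ := mul_le_mul_of_nonneg_left hsub hN0
  have a₂ := mul_le_mul_of_nonneg_left hL hN0
  have a₃ := mul_le_mul_of_nonneg_left hL1 (mul_nonneg hN0 hε.le)
  have a₄ := mul_nonneg hε.le (Nat.cast_nonneg (α := ℝ) u.length)
  have hlen : ((u ++ (List.replicate N r).flatten).length : ℝ) = u.length + N * L := by
    simp [hr]
  rw [hlen]
  push_cast
  nlinarith

theorem mainTheorem1 :
    ∃ S : ℕ → Bool, ∀ α : ℝ, 0 < α → α < 1 → FSDepthGT S (1 - α) ∧ PDDepthLT S α := by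
  -- `k'` is fixed from `k` and the precision before `S` is built, since it must serve infinitely
  -- many prefixes at once.
  choose k' hk' using fun p : ℕ × ℕ =>
    exists_extension_fsComplexity_gap p.1 (Nat.one_div_pos_of_nat (α := ℝ) (n := p.2))
  obtain ⟨S, hS⟩ := exists_sequence_frequently
    (ι := (ℕ × ℕ) ⊕ ({C : PDC Bool // C.IsIL} × ℕ))
    (Sum.elim
      (fun p w => (((1 - 1 / ((p.2 : ℝ) + 1)) * w.length : ℝ) : EReal) ≤
        ((fsComplexity p.1 w : ENNReal) : EReal) - ((fsComplexity (k' p) w : ENNReal) : EReal))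
      (fun p w => (1 - 1 / ((p.2 : ℝ) + 1)) * w.length ≤ ((p.1.1.output w).length : ℝ)))
    (by
      rintro (p | p) u
      · exact hk' p u
      · exact p.1.2.exists_incompressible_extension Nat.one_div_pos_of_nat u)
  refine ⟨S, fun α hα _ => ?_⟩
  obtain ⟨j, hj⟩ := exists_nat_one_div_lt hα
  constructor
  · refine ⟨1 - 1 / ((j : ℝ) + 1), by linarith, fun k => ⟨k' (k, j), ?_⟩⟩
    refine (hS (Sum.inl (k, j))).mono fun n hn => ?_
    simpa only [Sum.elim_inl, length_seqPrefix] using hn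
  · intro h
    -- Against the copier, `C` saves at most `n / (j + 1) < α * n` bits at infinitely many `n`.
    obtain ⟨C, hC, hev⟩ := h (PDC.copier Unit) (PDC.copier_isIL Unit)
    obtain ⟨n, hn, hCn, hpos⟩ :=
      ((hS (Sum.inr (⟨C, hC⟩, j))).and_eventually (hev.and (eventually_gt_atTop 0))).exists
    simp only [Sum.elim_inr, length_seqPrefix] at hn
    rw [PDC.copier_output, length_seqPrefix] at hCn
    have hpos' : (0 : ℝ) < n := by exact_mod_cast hpos
    nlinarith [mul_lt_mul_of_pos_right hj hpos']
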